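/- Fix a field $K$; all abelian and triangulated categories and all exact functors are $K$-linear. Let $\mathcal A$ be an abelian category with finite-dimensional $\mathrm{Hom}$'s, regarded as a full subcategory of its bounded derived category $D^b(\mathcal A)$ (complexes concentrated in degree $0$). Assume that $\mathcal A$ is of finite homological dimension, i.e. there is an integer $l$ such that $\mathrm{Hom}_{D^b(\mathcal A)}(A,B[i])=0$ for all $i>l$ and all $A,B\in\mathcal A$. Let $\{P_i\}_{i\in\mathbb Z}$ be an ample sequence in $\mathcal A$, i.e. a family of objects such that for every $B\in\mathcal A$ there is an integer $i(B)$ such that, for every $i\le i(B)$: 1. the natural morphism $\mathrm{Hom}_{\mathcal A}(P_i,B)\otimes P_i\to B$ is an epimorphism; 2. $\mathrm{Hom}_{D^b(\mathcal A)}(P_i,B[j])=0$ for all $j\neq 0$; 3. $\mathrm{Hom}_{\mathcal A}(B,P_i)=0$. Let $\mathcal C\subseteq D^b(\mathcal A)$ be the full subcategory whose objects are the $P_i$, $i\in\mathbb Z$. Let $\mathcal D$ be a triangulated category and let $F_1,F_2:D^b(\mathcal A)\to\mathcal D$ be exact functors such that * (i) there is an isomorphism of functors $f:F_2|_{\mathcal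 C}\xrightarrow{\ \sim\ }F_1|_{\mathcal C}$; * (ii) $\mathrm{Hom}_{\mathcal D}(F_1(A),F_1(B)[j])=0$ for all $A,B\in\mathcal A$ and all $j<0$; * (iii) $F_1$ has a left adjoint. Then there is an isomorphism of functors $g:F_2\xrightarrow{\ \sim\ }F_1$ which extends $f$, i.e. $g|_{\mathcal C}=f$. -/

import Mathlib

open CategoryTheory Limits

attribute [-instance] CategoryTheory.catToReflQuiver

universe w v u t v' u'

namespace TwistedFM

attribute [local instance] Abelian.hasFiniteBiproducts

section Tensor

variable (K : Type t) [Field K] {A : Type u} [Category.{v} A] [Abelian A] [Linear K A]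

/-- The object `V ⊗ P`, for a finite-dimensional vector space `V` and an object `P` of a `K`-linear
abelian category: the sum of copies of `P` indexed by a basis of `V`. -/
noncomputable def tensorObj (V : Type v) [AddCommGroup V] [Module K V] [FiniteDimensional K V]
    (P : A) : A :=
  ⨁ fun _ : Fin (Module.finrank K V) => P

/-- The morphism `V ⊗ P ⟶ B` which corresponds to a `K`-linear map `V → Hom(P, B)`. -/
noncomputable def tensorDesc {V : Type v} [AddCommGroup V] [Module K V] [FiniteDimensional K V]
    {P B : A} (φ : V →ₗ[K] (P ⟶ B)) : tensorObj K V P ⟶ B :=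
  biproduct.desc fun k => φ (Module.finBasis K V k)

/-- The `K`-linear map `V → Hom(P, V ⊗ P)`, `v ↦ (p ↦ v ⊗ p)`. -/
noncomputable def tensorIncl (V : Type v) [AddCommGroup V] [Module K V] [FiniteDimensional K V]
    (P : A) : V →ₗ[K] (P ⟶ tensorObj K V P) :=
  (Module.finBasis K V).constr K fun k =>
    biproduct.ι (fun _ : Fin (Module.finrank K V) => P) k

/-- `V ⊗ P` has the universal property of the tensor product: `tensorDesc K φ` is the unique
morphism that restricts to `φ v` along `v ⊗ -`, for every `v`. -/
theorem tensor_universal {V : Type v} [AddCommGroup V] [Module K V] [FiniteDimensional K V]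
    {P B : A} (φ : V →ₗ[K] (P ⟶ B)) (g : tensorObj K V P ⟶ B) :
    (∀ x : V, tensorIncl K V P x ≫ g = φ x) ↔ g = tensorDesc K φ := by
  have hι : ∀ k, tensorIncl K V P (Module.finBasis K V k) =
      biproduct.ι (fun _ : Fin (Module.finrank K V) => P) k :=
    fun k => Module.Basis.constr_basis _ _ _ _
  have hd : ∀ k, tensorIncl K V P (Module.finBasis K V k) ≫ tensorDesc K φ =
      φ (Module.finBasis K V k) := fun k => by
    rw [hι]
    exact biproduct.ι_desc _ _
  constructor
  · intro h
    refine biproduct.hom_ext' _ _ fun k => ?_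
    have := (h (Module.finBasis K V k)).trans (hd k).symm
    rwa [hι] at this
  · rintro rfl x
    have key : Linear.rightComp K P (tensorDesc K φ) ∘ₗ tensorIncl K V P = φ :=
      (Module.finBasis K V).ext hd
    exact LinearMap.congr_fun key x

/-- The natural morphism `Hom(P, B) ⊗ P ⟶ B`. -/
noncomputable def evalMor (P B : A) [FiniteDimensional K (P ⟶ B)] :
    tensorObj K (P ⟶ B) P ⟶ B :=
  tensorDesc K LinearMap.id

end Tensor

section Derived

variable (A : Type u) [Category.{v} A] [Abelian A] [HasDerivedCategory.{w} A]

/-- The embedding of an abelian category in its bounded derived category, as the complexes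
concentrated in degree `0`. -/
noncomputable def toDb : A ⥤ DerivedCategory.Bounded A :=
  DerivedCategory.TStructure.t.bounded.lift (DerivedCategory.singleFunctor A 0)
    fun _ => ⟨⟨0, inferInstance⟩, ⟨0, inferInstance⟩⟩

/-- `A` is of finite homological dimension: there is an integer `l` such that
`Hom(X, Y[i]) = 0` in the bounded derived category, for all `i > l` and all `X`, `Y` in `A`. -/
def FiniteHomologicalDimension : Prop :=
  ∃ l : ℤ, ∀ i : ℤ, l < i → ∀ X Y : A,
    ∀ φ : (toDb A).obj X ⟶ ((toDb A).obj Y)⟦i⟧, φ = 0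

variable {A}

/-- Ample sequences in a `K`-linear abelian category with finite-dimensional `Hom`'s. -/
def IsAmpleSequence (K : Type t) [Field K] [Linear K A]
    [∀ X Y : A, FiniteDimensional K (X ⟶ Y)] (P : ℤ → A) : Prop :=
  ∀ B : A, ∃ i₀ : ℤ, ∀ i : ℤ, i ≤ i₀ →
    Epi (evalMor K (P i) B) ∧
    (∀ j : ℤ, j ≠ 0 → ∀ φ : (toDb A).obj (P i) ⟶ ((toDb A).obj B)⟦j⟧, φ = 0) ∧
    (∀ φ : B ⟶ P i, φ = 0)

/-- The property of being one of the objects `P i`, seen in the bounded derived category. -/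
abbrev seqProp (P : ℤ → A) : ObjectProperty (DerivedCategory.Bounded A) :=
  ObjectProperty.ofObj fun i => (toDb A).obj (P i)

/-- The inclusion in the bounded derived category of its full subcategory whose objects are the
`P i`. -/
noncomputable abbrev seqIncl (P : ℤ → A) :
    (seqProp P).FullSubcategory ⥤ DerivedCategory.Bounded A :=
  (seqProp P).ι

end Derived

end TwistedFM

/-! Everything rests on covers: for `X` with cohomology in degrees `≤ b`, a triangle `Y ⟶ Q ⟶ X ⟶
Y⟦1⟧` with `Q` a summand of a sum of copies of `R i⟦-b⟧` and `Y⟦1⟧` in degrees `≤ b - 1`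
(`IsAmpleFamily.cover`). Passing along `δ : X ⟶ Y⟦1⟧` shortens `X` from above. Finite homological
dimension makes this terminate: a morphism from a fixed object into sufficiently low degrees is
zero.

Two vanishing results make choices unique. Since `F₂` and `F₁` agree on the sequence, hypothesis
(ii) gives `Hom(F₂ X, F₁ Y) = 0` when `X` lies in degrees `≤ b` and `Y` in degrees `> b`
(`hom_eq_zero`). The left adjoint turns this into `Hom(F₂ X, F₁ Q) = 0` for covers `Q` with `i ≪ 0`
(`hom_to_seq_eq_zero`), so that lifts along `F₁ δ` are unique.

The transformation is built on shifts of objects of the heart by descent along covers, with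
naturality for higher Ext classes obtained by dimension shifting (`pure_naturality`). It is then
extended by induction on cohomological amplitude (`exists_isNaturalTo`, `isNaturalTo_naturality`).
It is invertible by four-lemma chases along covers (`exists_section_app`, `isIso_app`). -/

namespace TwistedFM

open Pretriangulated Triangulated

section Shift

variable {T : Type*} [Category* T] [Preadditive T] [HasShift T ℤ]
  [∀ n : ℤ, (shiftFunctor T n).Additive]

/-- Vanishing of morphisms `A ⟶ B⟦c⟧` implies that of morphisms `A⟦a⟧ ⟶ B⟦b⟧`, if `c = b - a`. -/
lemma shift_hom_eq_zero {A B : T} (a b c : ℤ) (hc : b + -a = c) (h : ∀ g : A ⟶ B⟦c⟧, g = 0)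
    (g : A⟦a⟧ ⟶ B⟦b⟧) : g = 0 := by
  apply (shiftFunctor T (-a)).map_injective
  rw [Functor.map_zero, ← cancel_mono ((shiftFunctorAdd' T b (-a) c hc).inv.app B),
    ← cancel_epi ((shiftFunctorCompIsoId T a (-a) (by lia)).inv.app A)]
  simp only [zero_comp, comp_zero]
  exact h _

end Shift

/-! ### Summands of finite sums of copies of an object -/

section SumOf

variable {T : Type*} [Category* T] [Preadditive T]

/-- `Q` is a direct summand of a finite sum of copies of `R`. -/
def IsSumOf (R Q : T) : Prop :=
  ∃ (m : ℕ) (π : Fin m → (Q ⟶ R)) (ι : Fin m → (R ⟶ Q)), ∑ k, π k ≫ ι k = 𝟙 Q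

lemma IsSumOf.ext_from {R Q X : T} (h : IsSumOf R Q) {g g' : Q ⟶ X}
    (H : ∀ p : R ⟶ Q, p ≫ g = p ≫ g') : g = g' := by
  obtain ⟨m, π, ι, e⟩ := h
  rw [← Category.id_comp g, ← Category.id_comp g', ← e]
  simp [Preadditive.sum_comp, H]

lemma IsSumOf.eq_zero_from {R Q X : T} (h : IsSumOf R Q) (H : ∀ p : R ⟶ X, p = 0)
    (g : Q ⟶ X) : g = 0 :=
  h.ext_from fun p => by rw [H (p ≫ g), comp_zero]

lemma IsSumOf.eq_zero_to {R Q X : T} (h : IsSumOf R Q) (H : ∀ p : X ⟶ R, p = 0)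
    (g : X ⟶ Q) : g = 0 := by
  obtain ⟨m, π, ι, e⟩ := h
  rw [← Category.comp_id g, ← e]
  simp only [Preadditive.comp_sum, ← Category.assoc, H, zero_comp, Finset.sum_const_zero]

lemma IsSumOf.map {D : Type*} [Category* D] [Preadditive D] (F : T ⥤ D) [F.Additive] {R Q : T}
    (h : IsSumOf R Q) : IsSumOf (F.obj R) (F.obj Q) := by
  obtain ⟨m, π, ι, e⟩ := h
  exact ⟨m, fun k => F.map (π k), fun k => F.map (ι k), by
    simp only [← F.map_comp, ← F.map_sum, e, F.map_id]⟩

/-- A morphism `F₂ R ⟶ F₁ R` induces one at summands `Q` of sums of copies of `R`, compatible with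
the morphisms `S ⟶ Q` for all `S` such that the given one is compatible with `S ⟶ R`. -/
lemma IsSumOf.exists_hom {D : Type*} [Category* D] [Preadditive D] (F₁ F₂ : T ⥤ D)
    [F₁.Additive] [F₂.Additive] {R Q : T} (h : IsSumOf R Q) (f : F₂.obj R ⟶ F₁.obj R) :
    ∃ φ : F₂.obj Q ⟶ F₁.obj Q, ∀ (S : T) (f' : F₂.obj S ⟶ F₁.obj S),
      (∀ p : S ⟶ R, F₂.map p ≫ f = f' ≫ F₁.map p) →
      ∀ p : S ⟶ Q, F₂.map p ≫ φ = f' ≫ F₁.map p := by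
  obtain ⟨m, π, ι, e⟩ := h
  refine ⟨∑ k, F₂.map (π k) ≫ f ≫ F₁.map (ι k), fun S f' H p => ?_⟩
  have : F₁.map p = ∑ k, F₁.map (p ≫ π k) ≫ F₁.map (ι k) := by
    simp only [← F₁.map_comp, ← F₁.map_sum, Category.assoc, ← Preadditive.comp_sum, e,
      Category.comp_id]
  rw [this, Preadditive.comp_sum, Preadditive.comp_sum]
  refine Finset.sum_congr rfl fun k _ => ?_
  rw [← reassoc_of% H, F₂.map_comp, Category.assoc]

end SumOf

/-! ### Ample families and covers for a t-structure -/

section TStr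

variable {T : Type*} [Category* T] [Preadditive T] [HasZeroObject T] [HasShift T ℤ]
  [∀ n : ℤ, (shiftFunctor T n).Additive] [Pretriangulated T]
  (t : TStructure T)

section Exact

variable {X Y Z W : T} {f : X ⟶ Y} {g : Y ⟶ Z} {h : Z ⟶ X⟦(1 : ℤ)⟧}
  (hd : Triangle.mk f g h ∈ distTriang T)
include hd

lemma dist_lift₂ (k : W ⟶ Y) (hk : k ≫ g = 0) : ∃ k' : W ⟶ X, k = k' ≫ f :=
  Triangle.coyoneda_exact₂ _ hd k hk

lemma dist_lift₃ (k : W ⟶ Z) (hk : k ≫ h = 0) : ∃ k' : W ⟶ Y, k = k' ≫ g :=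
  Triangle.coyoneda_exact₃ _ hd k hk

lemma dist_lift₁ (k : W ⟶ X⟦(1 : ℤ)⟧) (hk : k ≫ f⟦(1 : ℤ)⟧' = 0) : ∃ k' : W ⟶ Z, k = k' ≫ h :=
  Triangle.coyoneda_exact₁ _ hd k hk

lemma dist_desc₂ (k : Y ⟶ W) (hk : f ≫ k = 0) : ∃ k' : Z ⟶ W, k = g ≫ k' :=
  Triangle.yoneda_exact₂ _ hd k hk

lemma dist_desc₃ (k : Z ⟶ W) (hk : g ≫ k = 0) : ∃ k' : X⟦(1 : ℤ)⟧ ⟶ W, k = h ≫ k' :=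
  Triangle.yoneda_exact₃ _ hd k hk

lemma dist_desc₁ (k : X⟦(1 : ℤ)⟧ ⟶ W) (hk : h ≫ k = 0) :
    ∃ k' : Y⟦(1 : ℤ)⟧ ⟶ W, k = f⟦(1 : ℤ)⟧' ≫ k' := by
  obtain ⟨k', hk'⟩ := Triangle.yoneda_exact₂ _
    (rot_of_distTriang _ (rot_of_distTriang _ hd)) k hk
  -- Rotating twice turns `f⟦1⟧'` into its negative.
  exact ⟨-k', hk'.trans ((Preadditive.neg_comp (f⟦(1 : ℤ)⟧') k').trans
    (Preadditive.comp_neg _ _).symm)⟩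

lemma dist_of_iso₃ {Z' : T} (e : Z ≅ Z') : Triangle.mk f (g ≫ e.hom) (e.inv ≫ h) ∈ distTriang T :=
  isomorphic_distinguished _ hd _
    (Triangle.isoMk _ _ (Iso.refl _) (Iso.refl _) e.symm
      (show f ≫ 𝟙 Y = 𝟙 X ≫ f by simp) (show (g ≫ e.hom) ≫ e.inv = 𝟙 Y ≫ g by simp)
      (show (e.inv ≫ h) ≫ (𝟙 X)⟦(1 : ℤ)⟧' = e.inv ≫ h by simp))

end Exact

lemma exists_unshift_triangle {Y Q B : T} (b : ℤ) {y : Y ⟶ Q} {q : Q ⟶ B⟦b⟧}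
    {δ : B⟦b⟧ ⟶ Y⟦(1 : ℤ)⟧} (hd : Triangle.mk y q δ ∈ distTriang T) :
    ∃ (y' : Y⟦-b⟧ ⟶ Q⟦-b⟧) (q' : Q⟦-b⟧ ⟶ B) (δ' : B ⟶ Y⟦-b⟧⟦(1 : ℤ)⟧),
      Triangle.mk y' q' δ' ∈ distTriang T := by
  let S := (Triangle.shiftFunctor T (-b)).obj (Triangle.mk y q δ)
  let e : S.obj₃ ≅ B := (shiftFunctorCompIsoId T b (-b) (by lia)).app B
  have hS : S ∈ distTriang T := Triangle.shift_distinguished _ hd (-b)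
  exact ⟨_, _, _, dist_of_iso₃ hS e⟩

/-- Dévissage of bounded objects with respect to a t-structure. -/
lemma tStructure_induction [IsTriangulated T] (p : T → Prop) (a b : ℤ) (hab : a ≤ b)
    (hext : ∀ S ∈ distTriang T, p S.obj₁ → p S.obj₃ → p S.obj₂)
    (hpure : ∀ (X : T) (n : ℤ), a ≤ n → n ≤ b → t.IsGE X n → t.IsLE X n → p X)
    (X : T) (hge : t.IsGE X a) (hle : t.IsLE X b) : p X := by
  obtain ⟨n, rfl⟩ : ∃ n : ℕ, b = a + n := ⟨(b - a).toNat, by lia⟩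
  induction n generalizing a X with
  | zero => exact hpure X a le_rfl (by lia) hge (by simpa using hle)
  | succ n ih =>
    -- Peel off the lowest cohomology object, in degree `a`.
    refine hext _ (t.triangleLTGE_distinguished (a + 1) X) ?_ ?_
    · exact hpure _ a le_rfl (by lia) (inferInstanceAs (t.IsGE ((t.truncLT (a + 1)).obj X) a))
        (t.isLE_truncLT_obj X (a + 1) a)
    · have e : a + 1 + (n : ℤ) = a + ((n + 1 : ℕ) : ℤ) := by push_cast; ring
      refine ih (a + 1) _ ?_ (by lia) (fun Y m h1 h2 => hpure Y m (by lia) (by lia)) ?_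
      · exact inferInstanceAs (t.IsGE ((t.truncGE (a + 1)).obj X) (a + 1))
      · rw [e]
        exact inferInstanceAs (t.IsLE ((t.truncGE (a + 1)).obj X) _)

variable (R : ℤ → T)

/-- An ample sequence in the heart of a bounded t-structure of finite homological dimension. -/
structure IsAmpleFamily : Prop where
  exists_isGE (X : T) : ∃ a, t.IsGE X a
  exists_isLE (X : T) : ∃ b, t.IsLE X b
  isGE (i : ℤ) : t.IsGE (R i) 0
  isLE (i : ℤ) : t.IsLE (R i) 0
  exists_cover (B : T) : t.IsGE B 0 → t.IsLE B 0 → ∃ i₀, ∀ i ≤ i₀, ∃ (Y Q : T) (y : Y ⟶ Q)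
    (q : Q ⟶ B) (δ : B ⟶ Y⟦(1 : ℤ)⟧), Triangle.mk y q δ ∈ distTriang T ∧ IsSumOf (R i) Q ∧
      t.IsGE Q 0 ∧ t.IsLE Q 0 ∧ t.IsLE Y 0
  hom_shift_eq_zero (B : T) : t.IsGE B 0 → t.IsLE B 0 → ∃ i₀, ∀ i ≤ i₀, ∀ j : ℤ, j ≠ 0 →
    ∀ g : R i ⟶ B⟦j⟧, g = 0
  hom_to_eq_zero (B : T) : t.IsGE B 0 → t.IsLE B 0 → ∃ i₀, ∀ i ≤ i₀, ∀ g : B ⟶ R i, g = 0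
  finite_dim : ∃ l : ℤ, ∀ j : ℤ, l < j → ∀ B C : T, t.IsGE B 0 → t.IsLE B 0 → t.IsGE C 0 →
    t.IsLE C 0 → ∀ g : B ⟶ C⟦j⟧, g = 0

variable {t R}

lemma isGE_shift_self {X : T} {n : ℤ} (h : t.IsGE X n) : t.IsGE (X⟦n⟧) 0 :=
  t.isGE_shift X n n 0

lemma isLE_shift_self {X : T} {n : ℤ} (h : t.IsLE X n) : t.IsLE (X⟦n⟧) 0 :=
  t.isLE_shift X n n 0

namespace IsAmpleFamily

variable (hR : IsAmpleFamily t R)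
include hR

lemma isGE_shift (i b : ℤ) : t.IsGE ((R i)⟦-b⟧) b :=
  have := hR.isGE i
  t.isGE_shift (R i) 0 (-b) b

lemma isLE_shift (i b : ℤ) : t.IsLE ((R i)⟦-b⟧) b :=
  have := hR.isLE i
  t.isLE_shift (R i) 0 (-b) b

/-- By dévissage `X` is pure of some degree `n < b`, and the morphisms become an Ext group from `R
i` in the nonzero degree `b - n`. -/
lemma hom_from_eq_zero [IsTriangulated T] (b : ℤ) {c : ℤ} (hc : c < b) (X : T) (hX : t.IsLE X c) :
    ∃ i₀, ∀ i ≤ i₀, ∀ g : (R i)⟦-b⟧ ⟶ X, g = 0 := by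
  obtain ⟨a, ha⟩ := hR.exists_isGE X
  refine tStructure_induction t (fun X => ∃ i₀, ∀ i ≤ i₀, ∀ g : (R i)⟦-b⟧ ⟶ X, g = 0)
    (min a c) c (min_le_right _ _) ?_ ?_ X (t.isGE_of_ge X (min a c) a (min_le_left _ _)) hX
  · rintro S hS ⟨i₁, h₁⟩ ⟨i₃, h₃⟩
    refine ⟨min i₁ i₃, fun i hi g => ?_⟩
    obtain ⟨g', rfl⟩ := Triangle.coyoneda_exact₂ S hS g (h₃ i (hi.trans (min_le_right _ _)) _)
    rw [h₁ i (hi.trans (min_le_left _ _)) g', zero_comp]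
  · intro Y n _ hn hge hle
    obtain ⟨i₀, h⟩ := hR.hom_shift_eq_zero _ (isGE_shift_self hge) (isLE_shift_self hle)
    refine ⟨i₀, fun i hi g => ?_⟩
    rw [← cancel_mono ((shiftFunctorCompIsoId T n (-n) (by lia)).inv.app Y), zero_comp]
    exact shift_hom_eq_zero (-b) (-n) (b - n) (by lia) (h i hi (b - n) (by lia)) _

lemma exists_hom_eq_zero [IsTriangulated T] (X : T) : ∃ c, ∀ Z, t.IsLE Z c → ∀ g : X ⟶ Z, g = 0 := by
  obtain ⟨a, ha⟩ := hR.exists_isGE X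
  obtain ⟨b, hb⟩ := hR.exists_isLE X
  obtain ⟨l, hl⟩ := hR.finite_dim
  refine tStructure_induction t (fun X => ∃ c, ∀ Z, t.IsLE Z c → ∀ g : X ⟶ Z, g = 0)
    a (max a b) (le_max_left _ _) ?_ ?_ X ha (t.isLE_of_le X b _ (le_max_right _ _))
  · rintro S hS ⟨c₁, h₁⟩ ⟨c₃, h₃⟩
    refine ⟨min c₁ c₃, fun Z hZ g => ?_⟩
    obtain ⟨g', rfl⟩ := Triangle.yoneda_exact₂ S hS g
      (h₁ Z (t.isLE_of_le Z (min c₁ c₃) c₁ (min_le_left _ _)) _)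
    rw [h₃ Z (t.isLE_of_le Z (min c₁ c₃) c₃ (min_le_right _ _)) g', comp_zero]
  · intro Y n _ _ hge hle
    -- From degree `n` to degree `m ≤ n - l - 1`, morphisms are Ext classes of degree `n - m > l`.
    refine ⟨n - l - 1, fun Z hZ => ?_⟩
    obtain ⟨a', ha'⟩ := hR.exists_isGE Z
    refine tStructure_induction t (fun Z => ∀ g : Y ⟶ Z, g = 0) (min a' (n - l - 1)) (n - l - 1)
      (min_le_right _ _) ?_ ?_ Z (t.isGE_of_ge Z _ a' (min_le_left _ _)) hZ
    · intro S hS h₁ h₃ g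
      obtain ⟨g', rfl⟩ := Triangle.coyoneda_exact₂ S hS g (h₃ _)
      rw [h₁ g', zero_comp]
    · intro W m _ hm hge' hle' g
      rw [← cancel_mono ((shiftFunctorCompIsoId T m (-m) (by lia)).inv.app W), zero_comp,
        ← cancel_epi ((shiftFunctorCompIsoId T n (-n) (by lia)).hom.app Y), comp_zero]
      exact shift_hom_eq_zero (-n) (-m) (n - m) (by lia) (hl (n - m) (by lia) _ _
        (isGE_shift_self hge) (isLE_shift_self hle) (isGE_shift_self hge')
        (isLE_shift_self hle')) _

/-- Such a morphism factors through the top truncation of `X`, a shifted object of the heart. -/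
lemma hom_to_shift_eq_zero [IsTriangulated T] (b : ℤ) (X : T) (hX : t.IsLE X b) :
    ∃ i₀, ∀ i ≤ i₀, ∀ g : X ⟶ (R i)⟦-b⟧, g = 0 := by
  obtain ⟨i₀, h⟩ := hR.hom_to_eq_zero (((t.truncGE b).obj X)⟦b⟧)
    (isGE_shift_self inferInstance) (isLE_shift_self inferInstance)
  refine ⟨i₀, fun i hi g => ?_⟩
  have := hR.isGE_shift i b
  obtain ⟨g', rfl⟩ := t.descTruncGE_aux g b
  suffices g' = 0 by rw [this, comp_zero]
  apply (shiftFunctor T b).map_injective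
  rw [Functor.map_zero,
    ← cancel_mono ((shiftFunctorCompIsoId T (-b) b (by lia)).hom.app (R i)), zero_comp]
  exact h i hi _

end IsAmpleFamily

variable (t R) in
/-- A surjection on the top cohomology, from a sum of copies of `R i`, as a triangle. -/
structure Cover (b i : ℤ) (X : T) where
  {Y : T}
  {Q : T}
  y : Y ⟶ Q
  q : Q ⟶ X
  δ : X ⟶ Y⟦(1 : ℤ)⟧
  dist : Triangle.mk y q δ ∈ distTriang T
  sum : IsSumOf ((R i)⟦-b⟧) Q
  geQ : t.IsGE Q b
  leQ : t.IsLE Q b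
  leY : t.IsLE Y b

namespace Cover

variable {b i : ℤ} {X : T} (c : Cover t R b i X)

lemma y_q : c.y ≫ c.q = 0 := comp_distTriang_mor_zero₁₂ _ c.dist

lemma isLE : t.IsLE (c.Y⟦(1 : ℤ)⟧) (b - 1) :=
  have := c.leY
  t.isLE_shift c.Y b 1 (b - 1)

lemma isGE_Y (h : t.IsGE X b) : t.IsGE c.Y b := by
  refine t.isGE₂ _ (inv_rot_of_distTriang _ c.dist) b ?_ c.geQ
  have : t.IsGE (X⟦(-1 : ℤ)⟧) (b + 1) := t.isGE_shift X b (-1) (b + 1)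
  exact t.isGE_of_ge (X⟦(-1 : ℤ)⟧) b (b + 1)

/-- With `isLE`, this makes the amplitude drop by one along `δ`: `Y⟦1⟧` sits between `X` and `Q⟦1⟧`,
the latter in degree `b - 1`. -/
lemma isGE {a : ℤ} (h : t.IsGE X a) (hab : a < b) : t.IsGE (c.Y⟦(1 : ℤ)⟧) a := by
  have := c.geQ
  have : t.IsGE (c.Q⟦(1 : ℤ)⟧) (b - 1) := t.isGE_shift c.Q b 1 (b - 1)
  exact t.isGE₂ _ (rot_of_distTriang _ (rot_of_distTriang _ c.dist)) a h
    (t.isGE_of_ge (c.Q⟦(1 : ℤ)⟧) a (b - 1))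

lemma lift {P : T} (h : ∀ g : P ⟶ c.Y⟦(1 : ℤ)⟧, g = 0) (p : P ⟶ X) : ∃ r : P ⟶ c.Q, p = r ≫ c.q :=
  dist_lift₃ c.dist p (h _)

lemma desc {W : T} (u : X ⟶ W) (h : c.q ≫ u = 0) : ∃ g : c.Y⟦(1 : ℤ)⟧ ⟶ W, u = c.δ ≫ g :=
  dist_desc₃ c.dist u h

end Cover

/-- A cover of the top cohomology `B` lifts to `X`, the obstruction lying in morphisms from `R
i⟦-b⟧` to `L⟦1⟧`, which vanish for `i ≪ 0`. -/
lemma IsAmpleFamily.cover [IsTriangulated T] (hR : IsAmpleFamily t R) (b : ℤ) (X : T) (hX : t.IsLE X b) :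
    ∃ i₀, ∀ i ≤ i₀, Nonempty (Cover t R b i X) := by
  obtain ⟨L, B, hL, hB, l, π, ε, hτ⟩ := t.exists_triangle X (b - 1) b (by lia)
  rw [t.le_iff_isLE] at hL
  rw [t.ge_iff_isGE] at hB
  have hL1 : t.IsLE (L⟦(1 : ℤ)⟧) (b - 1 - 1) := t.isLE_shift _ (b - 1) 1 _
  have hB' : t.IsLE B b := t.isLE₂ _ (rot_of_distTriang _ hτ) b hX
    (t.isLE_of_le (L⟦(1 : ℤ)⟧) (b - 1 - 1) b)
  obtain ⟨i₁, h₁⟩ := hR.exists_cover (B⟦b⟧) (isGE_shift_self inferInstance)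
    (isLE_shift_self inferInstance)
  obtain ⟨i₂, h₂⟩ := hR.hom_from_eq_zero b (by lia) _ hL1
  refine ⟨min i₁ i₂, fun i hi => ?_⟩
  obtain ⟨Y, Q, y, q, δ, hd, hsum, hge, hle, hleY⟩ := h₁ i (hi.trans (min_le_left _ _))
  have hsum' : IsSumOf ((R i)⟦-b⟧) (Q⟦-b⟧) := hsum.map (shiftFunctor T (-b))
  have hleY' : t.IsLE (Y⟦-b⟧) b := t.isLE_shift Y 0 (-b) b
  have hleY1 : t.IsLE (Y⟦-b⟧⟦(1 : ℤ)⟧) (b - 1) := t.isLE_shift _ b 1 _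
  have hgeQ : t.IsGE (Q⟦-b⟧) b := t.isGE_shift Q 0 (-b) b
  have hleQ : t.IsLE (Q⟦-b⟧) b := t.isLE_shift Q 0 (-b) b
  have hleQ1 : t.IsLE (Q⟦-b⟧⟦(1 : ℤ)⟧) (b - 1) := t.isLE_shift _ b 1 _
  obtain ⟨y₁, q₁, δ₁, hd₁⟩ := exists_unshift_triangle b hd
  obtain ⟨r, hr⟩ := dist_lift₃ hτ q₁
    (hsum'.eq_zero_from (h₂ i (hi.trans (min_le_right _ _))) _)
  obtain ⟨Y', y', δ', hd'⟩ := distinguished_cocone_triangle₁ r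
  refine ⟨⟨y', r, δ', hd', hsum', hgeQ, hleQ, ?_⟩⟩
  suffices t.IsLE (Y'⟦(1 : ℤ)⟧) (b - 1) from t.isLE_of_shift Y' b 1 (b - 1)
  rw [t.isLE_iff_orthogonal (b - 1) b (by lia)]
  intro Z w hZ
  -- This composite factors through `B`, then through the shifted kernel of `Q ⟶ B`, which lies in
  -- degrees `≤ b - 1`.
  have hδw : δ' ≫ w = 0 := by
    have h1 : r ≫ δ' = 0 := comp_distTriang_mor_zero₂₃ _ hd'
    obtain ⟨d, hd₂⟩ := dist_desc₂ hτ (δ' ≫ w) (t.zero_of_isLE_of_isGE _ (b - 1) b (by lia) hL hZ)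
    obtain ⟨d', rfl⟩ := dist_desc₃ hd₁ d (by
      rw [hr, Category.assoc, ← hd₂, reassoc_of% h1, zero_comp])
    rw [hd₂, t.zero_of_isLE_of_isGE d' (b - 1) b (by lia) hleY1 hZ, comp_zero, comp_zero]
  obtain ⟨w', rfl⟩ := dist_desc₁ hd' w hδw
  rw [t.zero_of_isLE_of_isGE w' (b - 1) b (by lia) hleQ1 hZ, comp_zero]

end TStr

/-! ### Shifting morphisms between values of two functors -/

section ShiftHom

variable {T D : Type*} [Category* T] [Category* D] [HasShift T ℤ] [HasShift D ℤ]
  {F₁ F₂ : T ⥤ D} [F₁.CommShift ℤ] [F₂.CommShift ℤ]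

/-- The shift of a morphism `F₂ X ⟶ F₁ X`, as a morphism `F₂ (X⟦n⟧) ⟶ F₁ (X⟦n⟧)`. -/
noncomputable def shiftHom (n : ℤ) {X : T} (h : F₂.obj X ⟶ F₁.obj X) :
    F₂.obj (X⟦n⟧) ⟶ F₁.obj (X⟦n⟧) :=
  (F₂.commShiftIso n).hom.app X ≫ h⟦n⟧' ≫ (F₁.commShiftIso n).inv.app X

lemma shiftHom_naturality (n : ℤ) {X Y : T} {h : F₂.obj X ⟶ F₁.obj X} {k : F₂.obj Y ⟶ F₁.obj Y}
    {u : X ⟶ Y} (e : F₂.map u ≫ k = h ≫ F₁.map u) :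
    F₂.map (u⟦n⟧') ≫ shiftHom n k = shiftHom n h ≫ F₁.map (u⟦n⟧') := by
  have h₁ := (F₁.commShiftIso n).inv.naturality u
  have h₂ := (F₂.commShiftIso n).hom.naturality u
  dsimp at h₁ h₂
  simp only [shiftHom, Category.assoc, ← h₁, reassoc_of% h₂]
  simp only [← Functor.map_comp_assoc, e]

lemma shiftHom_add (a b c : ℤ) (hc : a + b = c) {X : T} (h : F₂.obj X ⟶ F₁.obj X) :
    F₂.map ((shiftFunctorAdd' T a b c hc).hom.app X) ≫ shiftHom b (shiftHom a h) =
      shiftHom c h ≫ F₁.map ((shiftFunctorAdd' T a b c hc).hom.app X) := by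
  have n := (shiftFunctorAdd' D a b c hc).hom.naturality h
  dsimp at n
  simp only [shiftHom, F₁.commShiftIso_add' hc, F₂.commShiftIso_add' hc,
    Functor.CommShift.isoAdd'_hom_app, Functor.CommShift.isoAdd'_inv_app]
  have hi : F₁.map ((shiftFunctorAdd' T a b c hc).inv.app X) ≫
      F₁.map ((shiftFunctorAdd' T a b c hc).hom.app X) = 𝟙 _ := by
    rw [← F₁.map_comp, Iso.inv_hom_id_app, F₁.map_id]
  simp only [Category.assoc, Functor.map_comp, hi, reassoc_of% n, Iso.inv_hom_id_app_assoc]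
  exact congrArg _ (congrArg _ (congrArg _ (congrArg _ (congrArg _ (Category.comp_id _).symm))))

lemma shiftHom_zero (n : ℤ) (hn : n = 0) {X : T} (h : F₂.obj X ⟶ F₁.obj X) :
    F₂.map ((shiftFunctorZero' T n hn).hom.app X) ≫ h =
      shiftHom n h ≫ F₁.map ((shiftFunctorZero' T n hn).hom.app X) := by
  subst hn
  simp [shiftHom, F₁.commShiftIso_zero, F₂.commShiftIso_zero, shiftFunctorZero', ← Functor.map_comp]

instance (n : ℤ) {X : T} (h : F₂.obj X ⟶ F₁.obj X) [IsIso h] : IsIso (shiftHom n h) := by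
  unfold shiftHom
  infer_instance

end ShiftHom

/-! ### Vanishing results, and the transformation on pure objects -/

section Functors

variable {T : Type*} [Category* T] [Preadditive T] [HasZeroObject T] [HasShift T ℤ]
  [∀ n : ℤ, (shiftFunctor T n).Additive] [Pretriangulated T]
  {D : Type*} [Category* D] [Preadditive D] [HasZeroObject D] [HasShift D ℤ]
  [∀ n : ℤ, (shiftFunctor D n).Additive] [Pretriangulated D]

/-- Completion of a morphism of distinguished triangles. -/
lemma dist_complete {X Y Z X' Y' Z' : D} {f : X ⟶ Y} {g : Y ⟶ Z} {h : Z ⟶ X⟦(1 : ℤ)⟧}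
    {f' : X' ⟶ Y'} {g' : Y' ⟶ Z'} {h' : Z' ⟶ X'⟦(1 : ℤ)⟧} (hd : Triangle.mk f g h ∈ distTriang D)
    (hd' : Triangle.mk f' g' h' ∈ distTriang D) (a : X ⟶ X') (b : Y ⟶ Y') (e : f ≫ b = a ≫ f') :
    ∃ c : Z ⟶ Z', g ≫ c = b ≫ g' ∧ h ≫ a⟦(1 : ℤ)⟧' = c ≫ h' :=
  complete_distinguished_triangle_morphism _ _ hd hd' a b e

section MapTriangle

variable (F : T ⥤ D) [F.CommShift ℤ] [F.IsTriangulated] {X Y Z : T} {W : D}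
  {f : X ⟶ Y} {g : Y ⟶ Z} {h : Z ⟶ X⟦(1 : ℤ)⟧} (hd : Triangle.mk f g h ∈ distTriang T)
include hd

lemma map_dist : Triangle.mk (F.map f) (F.map g) (F.map h ≫ (F.commShiftIso (1 : ℤ)).hom.app X) ∈
    distTriang D :=
  F.map_distinguished _ hd

lemma map_lift₃ (k : W ⟶ F.obj Z) (hk : k ≫ F.map h = 0) : ∃ k' : W ⟶ F.obj Y, k = k' ≫ F.map g :=
  dist_lift₃ (map_dist F hd) k (by rw [reassoc_of% hk, zero_comp])

lemma map_lift₂ (k : W ⟶ F.obj Y) (hk : k ≫ F.map g = 0) : ∃ k' : W ⟶ F.obj X, k = k' ≫ F.map f :=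
  dist_lift₂ (map_dist F hd) k hk

lemma map_lift₁ (k : W ⟶ F.obj (X⟦(1 : ℤ)⟧)) (hk : k ≫ F.map (f⟦(1 : ℤ)⟧') = 0) :
    ∃ k' : W ⟶ F.obj Z, k = k' ≫ F.map h := by
  have n := (F.commShiftIso (1 : ℤ)).hom.naturality f
  dsimp at n
  obtain ⟨k', hk'⟩ := dist_lift₁ (map_dist F hd) (k ≫ (F.commShiftIso (1 : ℤ)).hom.app X) (by
    rw [Category.assoc, ← n, reassoc_of% hk, zero_comp])
  exact ⟨k', by rwa [← Category.assoc, cancel_mono] at hk'⟩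

lemma map_desc₂ (k : F.obj Y ⟶ W) (hk : F.map f ≫ k = 0) : ∃ k' : F.obj Z ⟶ W, k = F.map g ≫ k' :=
  dist_desc₂ (map_dist F hd) k hk

lemma map_desc₃ (k : F.obj Z ⟶ W) (hk : F.map g ≫ k = 0) :
    ∃ k' : F.obj (X⟦(1 : ℤ)⟧) ⟶ W, k = F.map h ≫ k' := by
  obtain ⟨k', hk'⟩ := dist_desc₃ (map_dist F hd) k hk
  exact ⟨_, hk'.trans (Category.assoc _ _ _)⟩

end MapTriangle

variable (t : TStructure T) (R : ℤ → T) (F₁ F₂ : T ⥤ D) [F₁.CommShift ℤ] [F₂.CommShift ℤ]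
  [F₁.IsTriangulated] [F₂.IsTriangulated] (f : ∀ i, F₂.obj (R i) ≅ F₁.obj (R i))

/-- The hypotheses under which an isomorphism `F₂ ≅ F₁` on an ample sequence extends. -/
structure IsExtendable : Prop where
  ample : IsAmpleFamily t R
  naturality {i j : ℤ} (p : R i ⟶ R j) : F₂.map p ≫ (f j).hom = (f i).hom ≫ F₁.map p
  hom_neg (B C : T) : t.IsGE B 0 → t.IsLE B 0 → t.IsGE C 0 → t.IsLE C 0 → ∀ j : ℤ, j < 0 →
    ∀ g : F₁.obj B ⟶ (F₁.obj C)⟦j⟧, g = 0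
  adj : F₁.IsRightAdjoint

variable {t R F₁ F₂ f}

namespace IsExtendable

variable [IsTriangulated T] (H : IsExtendable t R F₁ F₂ f)
include H

lemma shift_naturality (n : ℤ) {i j : ℤ} (p : (R i)⟦n⟧ ⟶ (R j)⟦n⟧) :
    F₂.map p ≫ shiftHom n (f j).hom = shiftHom n (f i).hom ≫ F₁.map p := by
  obtain ⟨p, rfl⟩ := (shiftFunctor T n).map_surjective p
  exact shiftHom_naturality n (H.naturality p)

/-- The isomorphism `f i` replaces `F₂` by `F₁`; dévissage of `Y` then reduces to negative Ext
groups. -/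
lemma hom_seq_eq_zero (i m : ℤ) (Y : T) (hY : t.IsGE Y (m + 1))
    (d : F₂.obj ((R i)⟦-m⟧) ⟶ F₁.obj Y) : d = 0 := by
  obtain ⟨b, hb⟩ := H.ample.exists_isLE Y
  refine tStructure_induction t (fun Y => ∀ d : F₂.obj ((R i)⟦-m⟧) ⟶ F₁.obj Y, d = 0)
    (m + 1) (max (m + 1) b) (le_max_left _ _) ?_ ?_ Y hY (t.isLE_of_le Y b _ (le_max_right _ _)) d
  · intro S hS h₁ h₃ d
    obtain ⟨d', rfl⟩ := dist_lift₂ (F₁.map_distinguished S hS) d (h₃ _)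
    exact (congrArg (· ≫ F₁.map S.mor₁) (h₁ d')).trans zero_comp
  · intro Z n hn _ hge hle d
    rw [← cancel_epi (inv (shiftHom (-m) (f i).hom)), comp_zero,
      ← cancel_epi ((F₁.commShiftIso (-m)).inv.app (R i)), comp_zero,
      ← cancel_mono (F₁.map ((shiftFunctorCompIsoId T n (-n) (by lia)).inv.app Z)), zero_comp,
      ← cancel_mono ((F₁.commShiftIso (-n)).hom.app _), zero_comp]
    exact shift_hom_eq_zero (-m) (-n) (m - n) (by lia)
      (H.hom_neg _ _ (H.ample.isGE i) (H.ample.isLE i) (isGE_shift_self hge) (isLE_shift_self hle)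
        _ (by lia)) _

lemma hom_eq_zero (b : ℤ) (X Y : T) (hX : t.IsLE X b) (hY : t.IsGE Y (b + 1))
    (d : F₂.obj X ⟶ F₁.obj Y) : d = 0 := by
  obtain ⟨c, hc⟩ := H.ample.exists_hom_eq_zero X
  -- Keeping the morphism `u` from the fixed `X` lets the descent stop: once `Z` is in degrees `≤
  -- c`, `u` itself is zero.
  have key : ∀ (k : ℕ) (m : ℤ), m ≤ c + k → m ≤ b → ∀ (Z : T), t.IsLE Z m → ∀ (u : X ⟶ Z)
      (d : F₂.obj Z ⟶ F₁.obj Y), F₂.map u ≫ d = 0 := by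
    intro k
    induction k with
    | zero =>
      intro m hm _ Z hZ u d
      rw [hc Z (t.isLE_of_le Z m c (by lia)) u, Functor.map_zero, zero_comp]
    | succ k ih =>
      intro m hm hb Z hZ u d
      obtain ⟨i, h⟩ := H.ample.cover m Z hZ
      obtain ⟨C⟩ := h i le_rfl
      obtain ⟨d', rfl⟩ := map_desc₃ F₂ C.dist d ((C.sum.map F₂).eq_zero_from
        (H.hom_seq_eq_zero i m Y (t.isGE_of_ge Y (m + 1) (b + 1))) _)
      rw [← F₂.map_comp_assoc]
      exact ih (m - 1) (by lia) (by lia) _ C.isLE _ _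
  simpa using key (b - c).toNat b (by lia) le_rfl X hX (𝟙 X) d

/-- By adjunction and `hom_eq_zero`, the left adjoint sends `F₂.obj X` into degrees `≤ b`, where
ampleness applies. -/
lemma hom_to_seq_eq_zero (b : ℤ) (X : T) (hX : t.IsLE X b) :
    ∃ i₀, ∀ i ≤ i₀, ∀ d : F₂.obj X ⟶ F₁.obj ((R i)⟦-b⟧), d = 0 := by
  have := H.adj
  let a := Adjunction.ofIsRightAdjoint F₁
  have : t.IsLE (F₁.leftAdjoint.obj (F₂.obj X)) b := by
    rw [t.isLE_iff_orthogonal b (b + 1) rfl]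
    intro Z g hZ
    apply (a.homEquiv _ _).injective
    rw [H.hom_eq_zero b X Z hX hZ (a.homEquiv _ _ g),
      H.hom_eq_zero b X Z hX hZ (a.homEquiv _ _ 0)]
  obtain ⟨i₀, h⟩ := H.ample.hom_to_shift_eq_zero b _ this
  refine ⟨i₀, fun i hi d => (a.homEquiv _ _).symm.injective ?_⟩
  rw [h i hi ((a.homEquiv _ _).symm d), h i hi ((a.homEquiv _ _).symm 0)]

lemma hom_to_cover_eq_zero (b : ℤ) (X : T) (hX : t.IsLE X b) :
    ∃ i₀, ∀ i ≤ i₀, ∀ (Z : T) (C : Cover t R b i Z) (d : F₂.obj X ⟶ F₁.obj C.Q), d = 0 := by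
  obtain ⟨i₀, h⟩ := H.hom_to_seq_eq_zero b X hX
  exact ⟨i₀, fun i hi Z C => (C.sum.map F₁).eq_zero_to (h i hi)⟩

/-- The difference kills a cover, so it factors through `F₂.obj (Y⟦1⟧)` and vanishes by
`hom_eq_zero`. -/
lemma ext_of_seq {b : ℤ} {X W : T} (hX : t.IsLE X b) (hW : t.IsGE W b)
    {d d' : F₂.obj X ⟶ F₁.obj W}
    (h : ∃ i₀, ∀ i ≤ i₀, ∀ p : (R i)⟦-b⟧ ⟶ X, F₂.map p ≫ d = F₂.map p ≫ d') : d = d' := by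
  obtain ⟨i₀, h⟩ := h
  obtain ⟨i₁, h₁⟩ := H.ample.cover b X hX
  obtain ⟨C⟩ := h₁ (min i₀ i₁) (min_le_right _ _)
  obtain ⟨m, π, ι, e⟩ := C.sum
  rw [← sub_eq_zero]
  obtain ⟨d₁, hd₁⟩ := map_desc₃ F₂ C.dist (d - d') (by
    have : F₂.map C.q = ∑ k, F₂.map (π k) ≫ F₂.map (ι k ≫ C.q) := by
      simp only [← F₂.map_comp, ← F₂.map_sum, ← Category.assoc, ← Preadditive.sum_comp, e,
        Category.id_comp]
    rw [this, Preadditive.sum_comp]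
    refine Finset.sum_eq_zero fun k _ => ?_
    rw [Category.assoc, Preadditive.comp_sub, h _ (min_le_left _ _), sub_self, comp_zero])
  rw [hd₁, H.hom_eq_zero (b - 1) _ W C.isLE (by simpa using hW) d₁, comp_zero]

end IsExtendable

variable (F₁ F₂ f) in
/-- Morphisms `F₂ X ⟶ F₁ X` which are compatible with the given ones on `(R i)⟦-b⟧`. -/
def IsCompatible (b : ℤ) (X : T) (h : F₂.obj X ⟶ F₁.obj X) : Prop :=
  ∀ (i : ℤ) (p : (R i)⟦-b⟧ ⟶ X), F₂.map p ≫ h = shiftHom (-b) (f i).hom ≫ F₁.map p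

lemma IsCompatible.shift {b : ℤ} {Y : T} {h : F₂.obj Y ⟶ F₁.obj Y}
    (hh : IsCompatible F₁ F₂ f b Y h) :
    IsCompatible F₁ F₂ f (b - 1) (Y⟦(1 : ℤ)⟧) (shiftHom 1 h) := by
  intro i p
  let e := (shiftFunctorAdd' T (-b) 1 (-(b - 1)) (by lia)).app (R i)
  obtain ⟨q, hq⟩ := (shiftFunctor T (1 : ℤ)).map_surjective (e.inv ≫ p)
  have hp : p = e.hom ≫ q⟦(1 : ℤ)⟧' := by rw [hq, Iso.hom_inv_id_assoc]
  rw [hp, F₂.map_comp, F₁.map_comp, Category.assoc, shiftHom_naturality 1 (hh i q)]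
  have h₁ : F₂.map e.hom ≫ shiftHom 1 (shiftHom (-b) (f i).hom) =
      shiftHom (-(b - 1)) (f i).hom ≫ F₁.map e.hom :=
    shiftHom_add (-b) 1 (-(b - 1)) (by lia) (f i).hom
  rw [reassoc_of% h₁]

namespace IsExtendable

variable [IsTriangulated T] (H : IsExtendable t R F₁ F₂ f)
include H

lemma isCompatible_naturality {b : ℤ} {X Y : T} (hX : t.IsLE X b) (hY : t.IsGE Y b)
    {h : F₂.obj X ⟶ F₁.obj X} {k : F₂.obj Y ⟶ F₁.obj Y} (hh : IsCompatible F₁ F₂ f b X h)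
    (hk : IsCompatible F₁ F₂ f b Y k) (u : X ⟶ Y) : F₂.map u ≫ k = h ≫ F₁.map u :=
  H.ext_of_seq hX hY ⟨0, fun i _ p => by
    rw [reassoc_of% hh i p, ← F₂.map_comp_assoc, hk, F₁.map_comp]⟩

lemma isCompatible_sum {b i : ℤ} {Q : T} (hQ : IsSumOf ((R i)⟦-b⟧) Q) :
    ∃ φ, IsCompatible F₁ F₂ f b Q φ := by
  obtain ⟨φ, h⟩ := hQ.exists_hom F₁ F₂ (shiftHom (-b) (f i).hom)
  exact ⟨φ, fun j p => h _ _ (H.shift_naturality (-b)) p⟩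

/-- Compatibility with a morphism from a cover implies compatibility with all morphisms. -/
lemma isCompatible_of_cover {b i : ℤ} {X : T} (hge : t.IsGE X b)
    (C : Cover t R b i X) {φ : F₂.obj C.Q ⟶ F₁.obj C.Q} (hφ : IsCompatible F₁ F₂ f b C.Q φ)
    {h : F₂.obj X ⟶ F₁.obj X} (hh : F₂.map C.q ≫ h = φ ≫ F₁.map C.q) :
    IsCompatible F₁ F₂ f b X h := by
  intro j p
  obtain ⟨i₀, h₀⟩ := H.ample.hom_from_eq_zero b (by lia) _ C.isLE
  -- The morphism `p` need not lift to `C.Q`, but `r ≫ p` does for `k ≪ 0`.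
  refine H.ext_of_seq (H.ample.isLE_shift j b) hge ⟨i₀, fun k hk r => ?_⟩
  obtain ⟨s, hs⟩ := C.lift (h₀ k hk) (r ≫ p)
  rw [← F₂.map_comp_assoc, hs, F₂.map_comp, Category.assoc, hh, reassoc_of% hφ k s,
    ← F₁.map_comp, ← hs, F₁.map_comp, reassoc_of% H.shift_naturality (-b) r]

/-- The morphism on `C.Q` descends to `X`: its composite with `F₁.map C.q` vanishes on `F₂.obj C.Y`,
as tested on the sequence. -/
lemma exists_isCompatible (b : ℤ) (X : T) (hge : t.IsGE X b) (hle : t.IsLE X b) :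
    ∃ h, IsCompatible F₁ F₂ f b X h := by
  obtain ⟨i, h₁⟩ := H.ample.cover b X hle
  obtain ⟨C⟩ := h₁ i le_rfl
  obtain ⟨φ, hφ⟩ := H.isCompatible_sum C.sum
  obtain ⟨h, hh⟩ := map_desc₂ F₂ C.dist (φ ≫ F₁.map C.q) (H.ext_of_seq C.leY hge ⟨0, fun j _ p => by
    rw [comp_zero, ← F₂.map_comp_assoc, reassoc_of% hφ j, ← F₁.map_comp, Category.assoc, C.y_q,
      comp_zero, Functor.map_zero, comp_zero]⟩)
  exact ⟨h, H.isCompatible_of_cover hge C hφ hh.symm⟩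

lemma δ_naturality {b i : ℤ} {X : T} (hge : t.IsGE X b) (hle : t.IsLE X b) (C : Cover t R b i X)
    {h : F₂.obj X ⟶ F₁.obj X} (hh : IsCompatible F₁ F₂ f b X h) :
    ∃ k, IsCompatible F₁ F₂ f (b - 1) (C.Y⟦(1 : ℤ)⟧) k ∧ F₂.map C.δ ≫ k = h ≫ F₁.map C.δ := by
  obtain ⟨k, hk⟩ := H.exists_isCompatible b C.Y (C.isGE_Y hge) C.leY
  obtain ⟨φ, hφ⟩ := H.isCompatible_sum C.sum
  -- The completion is not canonical, but it is compatible, hence equal to `h` by uniqueness.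
  obtain ⟨h', h₂, h₃⟩ := dist_complete (map_dist F₂ C.dist) (map_dist F₁ C.dist) k φ
    (H.isCompatible_naturality C.leY C.geQ hk hφ C.y)
  have hh' := H.isCompatible_of_cover hge C hφ h₂
  have : h' = h := by
    have := H.isCompatible_naturality hle hge hh hh' (𝟙 X)
    rwa [F₁.map_id, F₂.map_id, Category.id_comp, Category.comp_id] at this
  subst this
  refine ⟨shiftHom 1 k, hk.shift, ?_⟩
  rw [← cancel_mono ((F₁.commShiftIso (1 : ℤ)).hom.app C.Y), Category.assoc h', ← h₃]
  simp [shiftHom]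

/-- Here `u` is an Ext class of degree `b - c`. In positive degree it factors through `δ` of a cover
with `i ≪ 0`, which lowers the degree by one. -/
lemma pure_naturality (n : ℕ) {b c : ℤ} (hbc : b ≤ c + n) {X Y : T}
    (hX : t.IsGE X b) (hX' : t.IsLE X b) (hY : t.IsGE Y c) (hY' : t.IsLE Y c)
    {h : F₂.obj X ⟶ F₁.obj X} {k : F₂.obj Y ⟶ F₁.obj Y} (hh : IsCompatible F₁ F₂ f b X h)
    (hk : IsCompatible F₁ F₂ f c Y k) (u : X ⟶ Y) : F₂.map u ≫ k = h ≫ F₁.map u := by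
  rcases lt_trichotomy b c with hlt | rfl | hgt
  · rw [H.hom_eq_zero b X Y hX' (t.isGE_of_ge Y (b + 1) c) (F₂.map u ≫ k),
      H.hom_eq_zero b X Y hX' (t.isGE_of_ge Y (b + 1) c) (h ≫ F₁.map u)]
  · exact H.isCompatible_naturality hX' hY hh hk u
  induction n generalizing b X with
  | zero => lia
  | succ n ih =>
    obtain ⟨i₁, h₁⟩ := H.ample.cover b X hX'
    obtain ⟨i₂, h₂⟩ := H.ample.hom_from_eq_zero b hgt Y hY'
    obtain ⟨C⟩ := h₁ (min i₁ i₂) (min_le_left _ _)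
    obtain ⟨u', rfl⟩ := C.desc u (C.sum.eq_zero_from (h₂ _ (min_le_right _ _)) _)
    obtain ⟨k', hk', e⟩ := H.δ_naturality hX hX' C hh
    have := C.isGE_Y hX
    have hge : t.IsGE (C.Y⟦(1 : ℤ)⟧) (b - 1) := t.isGE_shift C.Y b 1 (b - 1)
    have : F₂.map u' ≫ k = k' ≫ F₁.map u' := by
      rcases (show c ≤ b - 1 by lia).eq_or_lt with rfl | hlt
      · exact H.isCompatible_naturality C.isLE hY hk' hk u'
      · exact ih (by lia) hge C.isLE hk' u' hlt
    rw [F₂.map_comp, Category.assoc, this, reassoc_of% e, F₁.map_comp]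

end IsExtendable

end Functors

/-! ### Extension by induction on the amplitude -/

section Functors

variable {T : Type*} [Category* T] [Preadditive T] [HasZeroObject T] [HasShift T ℤ]
  [∀ n : ℤ, (shiftFunctor T n).Additive] [Pretriangulated T]
  {D : Type*} [Category* D] [Preadditive D] [HasZeroObject D] [HasShift D ℤ]
  [∀ n : ℤ, (shiftFunctor D n).Additive] [Pretriangulated D]

/-- Objects of cohomological amplitude at most `n`. -/
def HasAmplitude (t : TStructure T) (n : ℕ) (X : T) : Prop :=
  ∃ a b : ℤ, b ≤ a + n ∧ t.IsGE X a ∧ t.IsLE X b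

lemma HasAmplitude.mono {t : TStructure T} {n m : ℕ} (h : n ≤ m) {X : T}
    (hX : HasAmplitude t n X) : HasAmplitude t m X := by
  obtain ⟨a, b, hab, h₁, h₂⟩ := hX
  exact ⟨a, b, by lia, h₁, h₂⟩

lemma IsAmpleFamily.hasAmplitude {t : TStructure T} {R : ℤ → T} (hR : IsAmpleFamily t R) (X : T) :
    ∃ n, HasAmplitude t n X := by
  obtain ⟨a, ha⟩ := hR.exists_isGE X
  obtain ⟨b, hb⟩ := hR.exists_isLE X
  exact ⟨(b - a).toNat, a, b, by lia, ha, hb⟩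

lemma Cover.isGE_min {t : TStructure T} {R : ℤ → T} {b i : ℤ} {X : T} (C : Cover t R b i X) {a : ℤ}
    (h : t.IsGE X a) : t.IsGE (C.Y⟦(1 : ℤ)⟧) (min a (b - 1)) :=
  C.isGE (t.isGE_of_ge X (min a (b - 1)) a) (by lia)

lemma Cover.hasAmplitude {t : TStructure T} {R : ℤ → T} {b i : ℤ} {X : T} (C : Cover t R b i X)
    {n : ℕ} {a : ℤ} (h : t.IsGE X a) (hab : b ≤ a + (n + 1 : ℕ)) :
    HasAmplitude t n (C.Y⟦(1 : ℤ)⟧) :=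
  ⟨min a (b - 1), b - 1, by push_cast at hab; lia, C.isGE_min h, C.isLE⟩

lemma Cover.hasAmplitude_Q_shift {t : TStructure T} {R : ℤ → T} {b i : ℤ} {X : T}
    (C : Cover t R b i X) (n : ℕ) : HasAmplitude t n (C.Q⟦(1 : ℤ)⟧) :=
  have := C.geQ
  have := C.leQ
  ⟨b - 1, b - 1, by lia, t.isGE_shift C.Q b 1 (b - 1), t.isLE_shift C.Q b 1 (b - 1)⟩

variable {t : TStructure T} {R : ℤ → T} {F₁ F₂ : T ⥤ D}

variable (t) in
/-- Naturality on the objects of amplitude at most `n`. -/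
def IsNaturalOn (n : ℕ) (γ : ∀ X, F₂.obj X ⟶ F₁.obj X) : Prop :=
  ∀ X Y, HasAmplitude t n X → HasAmplitude t n Y → ∀ u : X ⟶ Y, F₂.map u ≫ γ Y = γ X ≫ F₁.map u

variable (t) in
/-- Compatibility of a morphism `F₂ X ⟶ F₁ X` with all maps to objects of amplitude at most `n`. -/
def IsNaturalTo (n : ℕ) (γ : ∀ X, F₂.obj X ⟶ F₁.obj X) (X : T) (h : F₂.obj X ⟶ F₁.obj X) : Prop :=
  ∀ Z, HasAmplitude t n Z → ∀ v : X ⟶ Z, F₂.map v ≫ γ Z = h ≫ F₁.map v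

lemma Cover.exists_hom [F₁.CommShift ℤ] [F₁.IsTriangulated] [F₂.Additive] {b i : ℤ} {X : T}
    (C : Cover t R b i X) {n : ℕ} {γ : ∀ X, F₂.obj X ⟶ F₁.obj X} (hγ : IsNaturalOn t n γ)
    (hC : HasAmplitude t n (C.Y⟦(1 : ℤ)⟧)) :
    ∃ h : F₂.obj X ⟶ F₁.obj X, F₂.map C.δ ≫ γ _ = h ≫ F₁.map C.δ := by
  refine map_lift₁ F₁ C.dist _ ?_
  rw [Category.assoc, ← hγ _ _ hC (C.hasAmplitude_Q_shift n), ← F₂.map_comp_assoc,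
    show C.δ ≫ C.y⟦(1 : ℤ)⟧' = 0 from comp_distTriang_mor_zero₃₁ _ C.dist, F₂.map_zero, zero_comp]

lemma Cover.ext_hom [F₁.CommShift ℤ] [F₁.IsTriangulated] {b i : ℤ} {X : T} {W : D}
    (C : Cover t R b i X) (hC : ∀ d : W ⟶ F₁.obj C.Q, d = 0) {d d' : W ⟶ F₁.obj X}
    (h : d ≫ F₁.map C.δ = d' ≫ F₁.map C.δ) : d = d' := by
  obtain ⟨k, hk⟩ := map_lift₃ F₁ C.dist (d - d') (by rw [Preadditive.sub_comp, h, sub_self])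
  rw [← sub_eq_zero, hk, hC k, zero_comp]

variable [F₁.CommShift ℤ] [F₂.CommShift ℤ] [F₁.IsTriangulated] [F₂.IsTriangulated]
  {f : ∀ i, F₂.obj (R i) ≅ F₁.obj (R i)} [IsTriangulated T]

namespace IsExtendable

variable (H : IsExtendable t R F₁ F₂ f)
include H

/-- For a cover, `Y⟦1⟧` has amplitude `n`, so `γ` is natural there and lifts along `F₁ δ` to a
morphism at `X`. -/
lemma exists_isNaturalTo {n : ℕ} {γ : ∀ X, F₂.obj X ⟶ F₁.obj X} (hγ : IsNaturalOn t n γ) {X : T}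
    (hX : HasAmplitude t (n + 1) X) : ∃ h, IsNaturalTo t n γ X h := by
  obtain ⟨a, b, hab, hge, hle⟩ := hX
  obtain ⟨i₁, h₁⟩ := H.ample.cover b X hle
  obtain ⟨i₂, h₂⟩ := H.hom_to_cover_eq_zero b X hle
  obtain ⟨C₀⟩ := h₁ (min i₁ i₂) (min_le_left _ _)
  obtain ⟨h, hh⟩ := C₀.exists_hom hγ (C₀.hasAmplitude hge hab)
  obtain ⟨i₃, h₃⟩ := H.ample.hom_from_eq_zero b (by lia) _ C₀.isLE
  -- Independence of the cover: for `i ≪ 0`, `C₀.δ` factors through `C.δ`, and lifts along `F₁.map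
  -- C₀.δ` are unique.
  have indep (i : ℤ) (hi : i ≤ i₃) (C : Cover t R b i X) :
      F₂.map C.δ ≫ γ _ = h ≫ F₁.map C.δ := by
    obtain ⟨k, hk⟩ := C.exists_hom hγ (C.hasAmplitude hge hab)
    obtain ⟨w, hw⟩ := C.desc C₀.δ (C.sum.eq_zero_from (h₃ i hi) _)
    suffices h = k by rw [this, hk]
    refine C₀.ext_hom (h₂ _ (min_le_right _ _) X C₀) ?_
    rw [← hh, hw, F₁.map_comp, F₂.map_comp, Category.assoc, ← reassoc_of% hk,
      hγ _ _ (C.hasAmplitude hge hab) (C₀.hasAmplitude hge hab)]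
  -- If `d < b`, then `v` factors through `δ` of a cover of `X`; otherwise a cover of `Z` lowers `d`
  -- without losing information.
  have key : ∀ (m : ℕ) (Z : T) (c d : ℤ), d ≤ c + n → d ≤ b - 1 + m → t.IsGE Z c → t.IsLE Z d →
      ∀ v : X ⟶ Z, F₂.map v ≫ γ Z = h ≫ F₁.map v := by
    intro m
    induction m with
    | zero =>
      intro Z c d hcd hd hZ hZ' v
      obtain ⟨i₄, h₄⟩ := H.ample.hom_from_eq_zero b (show d < b by lia) Z hZ'
      obtain ⟨C⟩ := h₁ (min i₁ (min i₃ i₄)) (by lia)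
      obtain ⟨w, rfl⟩ := C.desc v (C.sum.eq_zero_from (h₄ _ (by lia)) _)
      rw [F₁.map_comp, F₂.map_comp, Category.assoc,
        hγ _ _ (C.hasAmplitude hge hab) ⟨c, d, hcd, hZ, hZ'⟩, reassoc_of% indep _ (by lia) C]
    | succ m ih =>
      intro Z c d hcd hd hZ hZ' v
      by_cases hdb : d < b
      · exact ih Z c d hcd (by lia) hZ hZ' v
      obtain ⟨i₄, h₄⟩ := H.ample.cover d Z hZ'
      obtain ⟨i₅, h₅⟩ := H.hom_to_cover_eq_zero d X (t.isLE_of_le X b d)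
      obtain ⟨C⟩ := h₄ (min i₄ i₅) (min_le_left _ _)
      refine C.ext_hom (h₅ _ (min_le_right _ _) Z C) ?_
      rw [Category.assoc, Category.assoc, ← F₁.map_comp,
        ← hγ _ _ ⟨c, d, hcd, hZ, hZ'⟩ (C.hasAmplitude hZ (by push_cast; lia)),
        ← F₂.map_comp_assoc]
      exact ih _ (min c (d - 1)) (d - 1) (by lia) (by push_cast at hd; lia) (C.isGE_min hZ) C.isLE _
  refine ⟨h, fun Z ⟨c, d, hcd, hZ, hZ'⟩ => key (d - b + 1).toNat Z c d hcd (by lia) hZ hZ'⟩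

/-- If `b ≤ b'`, a cover of `X'` reduces to a target of amplitude `n`. If `b > b'`, `u` factors
through `δ` of a cover of `X`, and the source's top degree drops. -/
lemma isNaturalTo_naturality {n : ℕ} {γ : ∀ X, F₂.obj X ⟶ F₁.obj X} (hγ : IsNaturalOn t n γ)
    {X X' : T} {h : F₂.obj X ⟶ F₁.obj X} {h' : F₂.obj X' ⟶ F₁.obj X'}
    (hX : HasAmplitude t (n + 1) X) (hX' : HasAmplitude t (n + 1) X')
    (hh : IsNaturalTo t n γ X h) (hh' : IsNaturalTo t n γ X' h') (u : X ⟶ X') :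
    F₂.map u ≫ h' = h ≫ F₁.map u := by
  obtain ⟨a', b', hab', hge', hle'⟩ := hX'
  obtain ⟨a, b, hab, hge, hle⟩ := hX
  obtain ⟨m, hm⟩ : ∃ m : ℕ, b ≤ b' + m := ⟨(b - b').toNat, by lia⟩
  induction m generalizing X a b with
  | zero =>
    obtain ⟨i₁, h₁⟩ := H.ample.cover b' X' hle'
    obtain ⟨i₂, h₂⟩ := H.hom_to_cover_eq_zero b' X (t.isLE_of_le X b b')
    obtain ⟨C⟩ := h₁ (min i₁ i₂) (min_le_left _ _)
    refine C.ext_hom (h₂ _ (min_le_right _ _) X' C) ?_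
    have hC := C.hasAmplitude hge' hab'
    rw [Category.assoc, Category.assoc, ← hh' _ hC, ← F₁.map_comp, ← hh _ hC, F₂.map_comp,
      Category.assoc]
  | succ m ih =>
    by_cases hb : b ≤ b'
    · exact ih hh u a b hab hge hle (by lia)
    obtain ⟨i₁, h₁⟩ := H.ample.cover b X hle
    obtain ⟨i₂, h₂⟩ := H.ample.hom_from_eq_zero b (show b' < b by lia) X' hle'
    obtain ⟨C⟩ := h₁ (min i₁ i₂) (min_le_left _ _)
    obtain ⟨w, rfl⟩ := C.desc u (C.sum.eq_zero_from (h₂ _ (min_le_right _ _)) _)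
    have hC := C.hasAmplitude hge hab
    rw [F₁.map_comp, F₂.map_comp, Category.assoc, ← reassoc_of% hh _ hC]
    congr 1
    exact ih (fun Z hZ v => hγ _ _ hC hZ v) w (min a (b - 1)) (b - 1) (by push_cast at hab ⊢; lia)
      (C.isGE_min hge) C.isLE (by push_cast at hm; lia)

lemma exists_isNaturalOn_succ {n : ℕ} {γ : ∀ X, F₂.obj X ⟶ F₁.obj X} (hγ : IsNaturalOn t n γ) :
    ∃ γ' : ∀ X, F₂.obj X ⟶ F₁.obj X, IsNaturalOn t (n + 1) γ' ∧
      ∀ X, HasAmplitude t n X → γ' X = γ X := by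
  classical
  have h : ∀ X, ∃ h, HasAmplitude t (n + 1) X → IsNaturalTo t n γ X h := fun X => by
    by_cases hX : HasAmplitude t (n + 1) X
    · exact (H.exists_isNaturalTo hγ hX).imp fun _ h _ => h
    · exact ⟨0, fun h => (hX h).elim⟩
  choose γ' hγ' using h
  refine ⟨γ', fun X Y hX hY => H.isNaturalTo_naturality hγ hX hY (hγ' X hX) (hγ' Y hY),
    fun X hX => ?_⟩
  simpa using (hγ' X (hX.mono n.le_succ) X hX (𝟙 X)).symm

lemma exists_isNaturalOn_zero : ∃ γ : ∀ X, F₂.obj X ⟶ F₁.obj X, IsNaturalOn t 0 γ ∧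
    ∀ b X, t.IsGE X b → t.IsLE X b → IsCompatible F₁ F₂ f b X (γ X) := by
  classical
  have h : ∀ X, ∃ h, ∀ b, t.IsGE X b → t.IsLE X b → IsCompatible F₁ F₂ f b X h := fun X => by
    by_cases hX : ∃ b, t.IsGE X b ∧ t.IsLE X b
    · obtain ⟨b, hge, hle⟩ := hX
      obtain ⟨h, hh⟩ := H.exists_isCompatible b X hge hle
      refine ⟨h, fun c hge' hle' => ?_⟩
      obtain ⟨h', hh'⟩ := H.exists_isCompatible c X hge' hle'
      have := H.pure_naturality (b - c).toNat (by lia) hge hle hge' hle' hh hh' (𝟙 X)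
      rw [F₁.map_id, F₂.map_id, Category.id_comp, Category.comp_id] at this
      rwa [← this]
    · exact ⟨0, fun b h h' => (hX ⟨b, h, h'⟩).elim⟩
  choose γ hγ using h
  refine ⟨γ, fun X Y ⟨a, b, hab, hge, hle⟩ ⟨c, d, hcd, hge', hle'⟩ u => ?_, fun b X => hγ X b⟩
  have hX := t.isGE_of_ge X b a (by simpa using hab)
  have hY := t.isGE_of_ge Y d c (by simpa using hcd)
  exact H.pure_naturality (b - d).toNat (by lia) hX hle hY hle' (hγ X b hX hle) (hγ Y d hY hle') u

/-- The natural transformation on the whole category. -/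
lemma exists_natTrans : ∃ g : F₂ ⟶ F₁,
    ∀ b X, t.IsGE X b → t.IsLE X b → IsCompatible F₁ F₂ f b X (g.app X) := by
  classical
  obtain ⟨γ₀, hγ₀, hc⟩ := H.exists_isNaturalOn_zero
  choose! next hnext hext using fun (n : ℕ) (γ : ∀ X, F₂.obj X ⟶ F₁.obj X)
    (hγ : IsNaturalOn t n γ) => H.exists_isNaturalOn_succ hγ
  let γ : ℕ → ∀ X, F₂.obj X ⟶ F₁.obj X := fun n => Nat.rec γ₀ next n
  have hγ : ∀ n, IsNaturalOn t n (γ n) := fun n => by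
    induction n with
    | zero => exact hγ₀
    | succ n ih => exact hnext n _ ih
  have hγ' : ∀ (n m : ℕ), n ≤ m → ∀ X, HasAmplitude t n X → γ m X = γ n X := fun n m hnm X hX => by
    induction m, hnm using Nat.le_induction with
    | base => rfl
    | succ m hm ih => exact (hext m _ (hγ m) X (hX.mono hm)).trans ih
  -- At each `X` the sequence `γ n` is constant from `n = N X` on.
  choose N hN using H.ample.hasAmplitude
  refine ⟨⟨fun X => γ (N X) X, fun X Y u => ?_⟩, fun b X hge hle => ?_⟩
  · rw [← hγ' (N X) (max (N X) (N Y)) (le_max_left _ _) X (hN X),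
      ← hγ' (N Y) (max (N X) (N Y)) (le_max_right _ _) Y (hN Y)]
    exact hγ _ X Y ((hN X).mono (le_max_left _ _)) ((hN Y).mono (le_max_right _ _)) u
  · have : γ (N X) X = γ₀ X := hγ' 0 (N X) (Nat.zero_le _) X ⟨b, b, by simp, hge, hle⟩
    change IsCompatible F₁ F₂ f b X (γ (N X) X)
    rw [this]
    exact hc b X hge hle

end IsExtendable

lemma IsSumOf.isIso_app {T D : Type*} [Category* T] [Category* D] [Preadditive T] [Preadditive D]
    {F₁ F₂ : T ⥤ D} [F₁.Additive] [F₂.Additive] {R Q : T} (h : IsSumOf R Q) (g : F₂ ⟶ F₁)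
    [IsIso (g.app R)] : IsIso (g.app Q) := by
  obtain ⟨m, π, ι, e⟩ := h
  refine ⟨∑ k, F₁.map (π k) ≫ inv (g.app R) ≫ F₂.map (ι k), ?_, ?_⟩
  · rw [Preadditive.comp_sum, ← F₂.map_id, ← e, F₂.map_sum]
    refine Finset.sum_congr rfl fun k _ => ?_
    rw [← g.naturality_assoc, IsIso.hom_inv_id_assoc, F₂.map_comp]
  · rw [Preadditive.sum_comp, ← F₁.map_id, ← e, F₁.map_sum]
    refine Finset.sum_congr rfl fun k _ => ?_
    rw [Category.assoc, Category.assoc, g.naturality, IsIso.inv_hom_id_assoc, F₁.map_comp]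

/-! ### Invertibility of the transformation -/

section Iso

variable (g : F₂ ⟶ F₁) (hg : ∀ i n : ℤ, IsIso (g.app ((R i)⟦n⟧)))
include hg

lemma isIso_app_sum {b i : ℤ} {Q : T} (hQ : IsSumOf ((R i)⟦-b⟧) Q) : IsIso (g.app Q) :=
  have := hg i (-b)
  hQ.isIso_app g

lemma isIso_app_sum_shift {b i : ℤ} {Q : T} (hQ : IsSumOf ((R i)⟦-b⟧) Q) :
    IsIso (g.app (Q⟦(1 : ℤ)⟧)) := by
  have := hg i (-b + 1)
  have : IsIso (g.app ((R i)⟦-b⟧⟦(1 : ℤ)⟧)) :=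
    (NatTrans.isIso_app_iff_of_iso g ((shiftFunctorAdd T (-b) 1).app (R i))).1 this
  exact (hQ.map (shiftFunctor T (1 : ℤ))).isIso_app g

variable (hR : IsAmpleFamily t R)
include hR

lemma exists_section_app (X : T) : ∃ s : F₁.obj X ⟶ F₂.obj X, s ≫ g.app X = 𝟙 _ := by
  obtain ⟨c, hc⟩ := hR.exists_hom_eq_zero X
  obtain ⟨b, hb⟩ := hR.exists_isLE X
  -- Lift `F₁.map u` through `g.app Z`: first after `δ`, then correct the error, which comes from
  -- `F₁.obj C.Q`, where `g` is invertible.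
  have key : ∀ (k : ℕ) (m : ℤ), m ≤ c + k → ∀ (Z : T), t.IsLE Z m → ∀ u : X ⟶ Z,
      ∃ s : F₁.obj X ⟶ F₂.obj Z, s ≫ g.app Z = F₁.map u := by
    intro k
    induction k with
    | zero =>
      intro m hm Z hZ u
      exact ⟨0, by rw [hc Z (t.isLE_of_le Z m c (by lia)) u, Functor.map_zero, zero_comp]⟩
    | succ k ih =>
      intro m hm Z hZ u
      obtain ⟨i, h⟩ := hR.cover m Z hZ
      obtain ⟨C⟩ := h i le_rfl
      have := isIso_app_sum g hg C.sum
      have := isIso_app_sum_shift g hg C.sum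
      obtain ⟨s₁, hs₁⟩ := ih (m - 1) (by push_cast at hm; lia) _ C.isLE (u ≫ C.δ)
      obtain ⟨s₂, rfl⟩ := map_lift₁ F₂ C.dist s₁ (by
        rw [← cancel_mono (g.app (C.Q⟦(1 : ℤ)⟧)), Category.assoc, g.naturality, reassoc_of% hs₁,
          ← F₁.map_comp, Category.assoc,
          show C.δ ≫ C.y⟦(1 : ℤ)⟧' = 0 from comp_distTriang_mor_zero₃₁ _ C.dist]
        simp)
      obtain ⟨s₃, hs₃⟩ := map_lift₃ F₁ C.dist (F₁.map u - s₂ ≫ g.app Z) (by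
        rw [Preadditive.sub_comp, Category.assoc, ← g.naturality, ← F₁.map_comp, ← hs₁,
          Category.assoc, sub_self])
      refine ⟨s₂ + s₃ ≫ inv (g.app C.Q) ≫ F₂.map C.q, ?_⟩
      simp [← hs₃]
  simpa using key (b - c).toNat b (by lia) X hb (𝟙 X)

lemma isIso_app (X : T) : IsIso (g.app X) := by
  choose s hs using exists_section_app g hg hR
  obtain ⟨c, hc⟩ := hR.exists_hom_eq_zero X
  obtain ⟨b, hb⟩ := hR.exists_isLE X
  have key : ∀ (k : ℕ) (m : ℤ), m ≤ c + k → ∀ (Z : T), t.IsLE Z m → ∀ u : X ⟶ Z,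
      ∀ (W : D) (d : W ⟶ F₂.obj X), d ≫ g.app X = 0 → d ≫ F₂.map u = 0 := by
    intro k
    induction k with
    | zero =>
      intro m hm Z hZ u W d _
      rw [hc Z (t.isLE_of_le Z m c (by lia)) u, Functor.map_zero, comp_zero]
    | succ k ih =>
      intro m hm Z hZ u W d hd
      obtain ⟨i, h⟩ := hR.cover m Z hZ
      obtain ⟨C⟩ := h i le_rfl
      have := isIso_app_sum g hg C.sum
      have h₀ := ih (m - 1) (by push_cast at hm; lia) _ C.isLE (u ≫ C.δ) W d hd
      obtain ⟨d₁, hd₁⟩ := map_lift₃ F₂ C.dist (d ≫ F₂.map u) (by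
        rwa [Category.assoc, ← F₂.map_comp])
      obtain ⟨d₂, hd₂⟩ := map_lift₂ F₁ C.dist (d₁ ≫ g.app C.Q) (by
        rw [Category.assoc, ← g.naturality, ← reassoc_of% hd₁, g.naturality, reassoc_of% hd,
          zero_comp])
      -- The four lemma: `g.app C.Q` is injective and `g.app C.Y` surjective, by the sections
      -- already found.
      have : d₁ = d₂ ≫ s C.Y ≫ F₂.map C.y := by
        rw [← cancel_mono (g.app C.Q), hd₂]
        simp [reassoc_of% hs]
      rw [hd₁, this, Category.assoc, Category.assoc, ← F₂.map_comp, C.y_q, F₂.map_zero, comp_zero,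
        comp_zero]
  refine ⟨s X, ?_, hs X⟩
  rw [← sub_eq_zero]
  simpa using key (b - c).toNat b (by lia) X hb (𝟙 X) _ (g.app X ≫ s X - 𝟙 _) (by
    rw [Preadditive.sub_comp, Category.assoc, hs, Category.id_comp, Category.comp_id, sub_self])

end Iso

/-- An isomorphism between exact functors on an ample sequence extends. -/
theorem IsExtendable.exists_iso (H : IsExtendable t R F₁ F₂ f) :
    ∃ g : F₂ ≅ F₁, ∀ i, g.hom.app (R i) = (f i).hom := by
  obtain ⟨g, hg⟩ := H.exists_natTrans
  have hn (i n : ℤ) : IsIso (g.app ((R i)⟦n⟧)) := by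
    obtain ⟨b, rfl⟩ : ∃ b, n = -b := ⟨-n, by simp⟩
    have := hg b _ (H.ample.isGE_shift i b) (H.ample.isLE_shift i b) i (𝟙 _)
    rw [F₁.map_id, F₂.map_id, Category.id_comp, Category.comp_id] at this
    rw [this]
    infer_instance
  have := isIso_app g hn H.ample
  have : IsIso g := NatIso.isIso_of_isIso_app g
  refine ⟨asIso g, fun i => ?_⟩
  -- Compatibility for `b = 0` concerns `(R i)⟦-0⟧`, hence the canonical isomorphism to `R i`.
  have h₁ := hg 0 _ (H.ample.isGE i) (H.ample.isLE i) i
    ((shiftFunctorZero' T (-0 : ℤ) neg_zero).hom.app (R i))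
  rwa [← shiftHom_zero, cancel_epi] at h₁

end Functors

/-- Distinguished triangles lift along fully faithful triangulated functors. -/
lemma exists_triangle_of_map {T D : Type*} [Category* T] [Preadditive T] [HasZeroObject T]
    [HasShift T ℤ] [∀ n : ℤ, (shiftFunctor T n).Additive] [Pretriangulated T]
    [Category* D] [Preadditive D] [HasZeroObject D] [HasShift D ℤ]
    [∀ n : ℤ, (shiftFunctor D n).Additive] [Pretriangulated D] (F : T ⥤ D) [F.CommShift ℤ]
    [F.IsTriangulated] [F.Full] [F.Faithful] {X Y Z : T} {f : X ⟶ Y} {g : Y ⟶ Z}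
    {s : F.obj Z ⟶ (F.obj X)⟦(1 : ℤ)⟧} (hs : Triangle.mk (F.map f) (F.map g) s ∈ distTriang D) :
    ∃ δ, Triangle.mk f g δ ∈ distTriang T := by
  obtain ⟨δ, hδ⟩ := F.map_surjective (s ≫ (F.commShiftIso (1 : ℤ)).inv.app X)
  have hδ' : s = F.map δ ≫ (F.commShiftIso (1 : ℤ)).hom.app X := by
    rw [hδ, Category.assoc, Iso.inv_hom_id_app]
    exact (Category.comp_id _).symm
  subst hδ'
  exact ⟨δ, (F.map_distinguished_iff _).1 hs⟩

/-! ### The bounded derived category -/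

section Bounded

attribute [local instance] Abelian.hasFiniteBiproducts

lemma isSumOf_tensorObj (K : Type t) [Field K] {A : Type u}
    [Category.{v} A] [Abelian A] [Linear K A] (V : Type v) [AddCommGroup V]
    [Module K V] [FiniteDimensional K V] (P : A) : IsSumOf P (tensorObj K V P) :=
  ⟨_, fun k => biproduct.π (fun _ : Fin (Module.finrank K V) => P) k,
    fun k => biproduct.ι (fun _ : Fin (Module.finrank K V) => P) k, biproduct.total⟩

variable (A : Type u) [Category.{v} A] [Abelian A] [HasDerivedCategory.{w} A]

/-- The canonical t-structure on the bounded derived category. -/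
noncomputable abbrev tBounded : TStructure (DerivedCategory.Bounded A) :=
  (DerivedCategory.TStructure.t (C := A)).onBounded

variable {A}

instance : (toDb A).Additive where
  map_add {X Y f g} := by
    apply (DerivedCategory.Bounded.ι (C := A)).map_injective
    exact (DerivedCategory.singleFunctor A 0).map_add

lemma isGE_toDb (X : A) : (tBounded A).IsGE ((toDb A).obj X) 0 :=
  (ObjectProperty.tStructure_isGE_iff _ _ _ _).2
    (inferInstanceAs (((DerivedCategory.singleFunctor A 0).obj X).IsGE 0))

lemma isLE_toDb (X : A) : (tBounded A).IsLE ((toDb A).obj X) 0 :=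
  (ObjectProperty.tStructure_isLE_iff _ _ _ _).2
    (inferInstanceAs (((DerivedCategory.singleFunctor A 0).obj X).IsLE 0))

lemma exists_iso_toDb (B : DerivedCategory.Bounded A) (h : (tBounded A).IsGE B 0)
    (h' : (tBounded A).IsLE B 0) : ∃ X, Nonempty (B ≅ (toDb A).obj X) := by
  have := (ObjectProperty.tStructure_isGE_iff _ _ _ _).1 h
  have := (ObjectProperty.tStructure_isLE_iff _ _ _ _).1 h'
  obtain ⟨X, ⟨e⟩⟩ := DerivedCategory.exists_iso_singleFunctor_obj_of_isGE_of_isLE B.obj 0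
  exact ⟨X, ⟨(ObjectProperty.fullyFaithfulι _).preimageIso e⟩⟩

lemma exists_triangle_of_epi {X Y : A} (g : X ⟶ Y) [Epi g] :
    ∃ δ, Triangle.mk ((toDb A).map (kernel.ι g)) ((toDb A).map g) δ ∈
      distTriang (DerivedCategory.Bounded A) := by
  let S : ShortComplex A := ShortComplex.mk (kernel.ι g) g (kernel.condition g)
  have hS : S.ShortExact :=
    { exact := ShortComplex.exact_of_f_is_kernel _ (kernelIsKernel g)
      mono_f := inferInstanceAs (Mono (kernel.ι g))
      epi_g := inferInstanceAs (Epi g) }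
  let ι := DerivedCategory.Bounded.ι (C := A)
  let s : ι.obj ((toDb A).obj Y) ⟶ (ι.obj ((toDb A).obj (kernel g)))⟦(1 : ℤ)⟧ := hS.singleδ
  have hs : Triangle.mk (ι.map ((toDb A).map (kernel.ι g))) (ι.map ((toDb A).map g)) s ∈
      distTriang (DerivedCategory A) := hS.singleTriangle_distinguished
  exact exists_triangle_of_map ι hs

lemma hom_eq_zero_of_iso {T : Type*} [Category* T] [Preadditive T] {X X' Y Y' : T} (e : X' ≅ X)
    (e' : Y' ≅ Y) (h : ∀ g : X ⟶ Y, g = 0) (g : X' ⟶ Y') : g = 0 := by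
  rw [← cancel_mono e'.hom, ← cancel_epi e.inv, zero_comp, comp_zero]
  exact h _

lemma isAmpleFamily_toDb {K : Type t} [Field K] [Linear K A]
    [∀ X Y : A, FiniteDimensional K (X ⟶ Y)] (hdim : FiniteHomologicalDimension A) {P : ℤ → A}
    (hP : IsAmpleSequence K P) : IsAmpleFamily (tBounded A) fun i => (toDb A).obj (P i) where
  exists_isGE X := by
    obtain ⟨a, ha⟩ := X.property.1
    exact ⟨a, (ObjectProperty.tStructure_isGE_iff _ _ _ _).2 ha⟩
  exists_isLE X := by
    obtain ⟨b, hb⟩ := X.property.2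
    exact ⟨b, (ObjectProperty.tStructure_isLE_iff _ _ _ _).2 hb⟩
  isGE i := isGE_toDb _
  isLE i := isLE_toDb _
  exists_cover B h h' := by
    obtain ⟨X, ⟨e⟩⟩ := exists_iso_toDb B h h'
    obtain ⟨i₀, hi₀⟩ := hP X
    refine ⟨i₀, fun i hi => ?_⟩
    have := (hi₀ i hi).1
    obtain ⟨δ, hδ⟩ := exists_triangle_of_epi (evalMor K (P i) X)
    exact ⟨_, _, _, _, _, dist_of_iso₃ hδ e.symm, (isSumOf_tensorObj K _ _).map (toDb A),
      isGE_toDb _, isLE_toDb _, isLE_toDb _⟩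
  hom_shift_eq_zero B h h' := by
    obtain ⟨X, ⟨e⟩⟩ := exists_iso_toDb B h h'
    obtain ⟨i₀, hi₀⟩ := hP X
    exact ⟨i₀, fun i hi j hj => hom_eq_zero_of_iso (Iso.refl _)
      ((shiftFunctor _ j).mapIso e) ((hi₀ i hi).2.1 j hj)⟩
  hom_to_eq_zero B h h' := by
    obtain ⟨X, ⟨e⟩⟩ := exists_iso_toDb B h h'
    obtain ⟨i₀, hi₀⟩ := hP X
    refine ⟨i₀, fun i hi => hom_eq_zero_of_iso e (Iso.refl _) fun g => ?_⟩
    obtain ⟨g', hg'⟩ := (DerivedCategory.singleFunctor A 0).map_surjective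
      ((DerivedCategory.Bounded.ι (C := A)).map g)
    apply (DerivedCategory.Bounded.ι (C := A)).map_injective
    rw [← hg', (hi₀ i hi).2.2 g', Functor.map_zero, Functor.map_zero]
    rfl
  finite_dim := by
    obtain ⟨l, hl⟩ := hdim
    refine ⟨l, fun j hj B C hB hB' hC hC' => ?_⟩
    obtain ⟨X, ⟨e⟩⟩ := exists_iso_toDb B hB hB'
    obtain ⟨Y, ⟨e'⟩⟩ := exists_iso_toDb C hC hC'
    exact hom_eq_zero_of_iso e ((shiftFunctor _ j).mapIso e') (hl j hj X Y)

end Bounded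

end TwistedFM

theorem mainTheorem4 (K : Type t) [Field K]
    (A : Type u) [Category.{v} A] [Abelian A] [Linear K A]
    [∀ X Y : A, FiniteDimensional K (X ⟶ Y)]
    [HasDerivedCategory.{w} A]
    (D : Type u') [Category.{v'} D] [Preadditive D] [HasZeroObject D] [HasShift D ℤ]
    [∀ n : ℤ, (shiftFunctor D n).Additive] [Pretriangulated D] [IsTriangulated D]
    [Linear K D] [∀ n : ℤ, (shiftFunctor D n).Linear K]
    (hdim : TwistedFM.FiniteHomologicalDimension A)
    (P : ℤ → A) (hP : TwistedFM.IsAmpleSequence K P)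
    (F₁ F₂ : DerivedCategory.Bounded A ⥤ D)
    [F₁.CommShift ℤ] [F₁.IsTriangulated] [F₁.Linear K]
    [F₂.CommShift ℤ] [F₂.IsTriangulated] [F₂.Linear K]
    (f : TwistedFM.seqIncl P ⋙ F₂ ≅ TwistedFM.seqIncl P ⋙ F₁)
    (hneg : ∀ (X Y : A) (j : ℤ), j < 0 →
      ∀ φ : F₁.obj ((TwistedFM.toDb A).obj X) ⟶ (F₁.obj ((TwistedFM.toDb A).obj Y))⟦j⟧, φ = 0)
    (hadj : F₁.IsRightAdjoint) :
    ∃ g : F₂ ≅ F₁, Functor.isoWhiskerLeft (TwistedFM.seqIncl P) g = f := by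
  let Q (i : ℤ) : (TwistedFM.seqProp P).FullSubcategory :=
    ⟨(TwistedFM.toDb A).obj (P i), ObjectProperty.ofObj_apply _ i⟩
  have H : TwistedFM.IsExtendable (TwistedFM.tBounded A) (fun i => (TwistedFM.toDb A).obj (P i))
      F₁ F₂ (fun i => f.app (Q i)) :=
    { ample := TwistedFM.isAmpleFamily_toDb hdim hP
      naturality := fun {i j} p => f.hom.naturality (X := Q i) (Y := Q j) ⟨p⟩
      hom_neg := fun B C hB hB' hC hC' j hj => by
        obtain ⟨X, ⟨e⟩⟩ := TwistedFM.exists_iso_toDb B hB hB'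
        obtain ⟨Y, ⟨e'⟩⟩ := TwistedFM.exists_iso_toDb C hC hC'
        exact TwistedFM.hom_eq_zero_of_iso (F₁.mapIso e) ((F₁ ⋙ shiftFunctor D j).mapIso e')
          (hneg X Y j hj)
      adj := hadj }
  obtain ⟨g, hg⟩ := H.exists_iso
  refine ⟨g, ?_⟩
  ext ⟨X, hX⟩
  obtain ⟨i⟩ := hX
  exact hg i
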